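/- Let $q>0$, let $a:[0,\infty)\to[0,\infty)$ be continuous and let $r:[0,\infty)\to[0,q]$ satisfy $\sup_{t\ge 0} r(t)=q$. Consider the delay equation $$x'(t)=-a(t)\,x(t-r(t)),\qquad(1)$$ where $'$ is the right-hand derivative. For $s\ge 0$ and $\varphi\in C([-q,0],\mathbb R)$ (with the sup norm $\|\cdot\|_q$), a solution with initial value $\varphi$ at $s$ is a continuous function $x$ on $[s-q,\infty)$ with $x(s+\theta)=\varphi(\theta)$ for $-q\le\theta\le 0$ that satisfies (1) for all $t\ge s$. Write $x(\varphi)$ for the solution with initial value $\varphi$ at $s=0$. For $h\in(0,q]$ put $[t]_h=\lfloor t/h\rfloor h$, and let $z_h(\varphi)$ be the solution of $$z'(t)=-a(t)\,z\bigl(\bigl[t-[r([t]_h)]_h\bigr]_h\bigr),\qquad z(nh)=\varphi(nh)\ \text{ for all integers } n \text{ with } -q\le nh\le 0,$$ that is, a function, defined at these grid points and on $[0,\infty)$, continuous on $[0,\infty)$, differentiable there except possibly at the points $jh$, $j=0,1,2,\dots$, where finite one-sided derivatives exist, and satisfying the equation on each interval $[jh,(j+1)h)$ (with the right-hand derivative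 at $jh$). Assume that * (A1) the zero solution of (1) is uniformly asymptotically stable: for each $\varepsilon>0$ there is $\delta>0$ such that $\|\varphi\|_q<\delta$ implies $|x(t)|<\varepsilon$ for all $t\ge s$, and there is $b>0$ such that for each $\varepsilon>0$ there is $T>0$ such that $\|\varphi\|_q<b$ implies $|x(t)|<\varepsilon$ for all $t\ge s+T$, in both cases for every $s\ge0$ and every solution $x$ with initial value $\varphi$ at $s$; * (A2) $a_0:=\sup_{t\ge0}|a(t)|<\infty$; * (A3) $r$ is uniformly continuous on $[0,\infty)$. Let $w_r(\ell)=\sup\{|r(t_2)-r(t_1)|: t_1,t_2\ge0,\ |t_2-t_1|\le\ell\}$ and $t_0=3q+w_r(q)$. Then there are constants $K,\sigma,M_1,\eta>0$ and $h_0\in(0,q]$, depending only on $a$ and $r$, such that every solution of (1) with initial value $\phi$ at a time $s\ge0$ satisfies $|x(t)|\le K\|\phi\|_q e^{-\sigma(t-s)}$ for $t\ge s$, and such that, for every $h\in(0,h_0]$ and every $\varphi\in C([-q,0],\mathbb R)$, $$|x(\varphi)(t)-z_h(\varphi)(t)|\le\Bigl[K\,\|E_{h,t_0}\|_q+K_1(h)\,M_1\,\|\varphi\|_q\,t\Bigr]e^{-\eta(t-t_0)},\qquad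 t\ge t_0,$$ where $\|E_{h,t_0}\|_q=\sup_{t_0-q\le s\le t_0}|x(\varphi)(s)-z_h(\varphi)(s)|$ and $K_1(h)=a_0^2\,[2h+w_r(h)]\,K$. Moreover $K_1(h)\to0$ as $h\to0^+$. -/

import Mathlib

open Set Filter Topology

noncomputable section

namespace DelayEq

/-- `x` is a solution on `[s - q, ∞)` of `x'(t) = -a(t) x(t - r(t))`, where `'` is the right-hand
derivative, with initial value `φ ∈ C([-q, 0], ℝ)` at time `s`. Only the values of `x` on
`[s - q, ∞)` matter. -/
structure IsSolution (a r : ℝ → ℝ) (q s : ℝ) (φ : C(Icc (-q) 0, ℝ)) (x : ℝ → ℝ) : Prop where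
  continuousOn : ContinuousOn x (Ici (s - q))
  initial : ∀ θ : Icc (-q) 0, x (s + θ) = φ θ
  equation : ∀ t, s ≤ t → HasDerivWithinAt x (-a t * x (t - r t)) (Ici t) t

/-- The zero solution of `x'(t) = -a(t) x(t - r(t))` is uniformly stable. -/
def UniformlyStable (a r : ℝ → ℝ) (q : ℝ) : Prop :=
  ∀ ε > 0, ∃ δ > 0, ∀ s, 0 ≤ s → ∀ (φ : C(Icc (-q) 0, ℝ)) (x : ℝ → ℝ),
    IsSolution a r q s φ x → ‖φ‖ < δ → ∀ t, s ≤ t → |x t| < ε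

/-- The zero solution of `x'(t) = -a(t) x(t - r(t))` is uniformly asymptotically stable: it is
uniformly stable, and attracts a fixed ball of initial functions, uniformly with respect to the
initial function and the initial time. -/
def UniformlyAsymptoticallyStable (a r : ℝ → ℝ) (q : ℝ) : Prop :=
  UniformlyStable a r q ∧
    ∃ b > 0, ∀ ε > 0, ∃ T > 0, ∀ s, 0 ≤ s → ∀ (φ : C(Icc (-q) 0, ℝ)) (x : ℝ → ℝ),
      IsSolution a r q s φ x → ‖φ‖ < b → ∀ t, s + T ≤ t → |x t| < ε

/-- All solutions satisfy `|x(t)| ≤ K ‖φ‖ e^{-σ (t - s)}` for `t ≥ s`, where `φ` is the initial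
value at the initial time `s ≥ 0`. -/
def ExponentialEstimate (a r : ℝ → ℝ) (q K σ : ℝ) : Prop :=
  ∀ s, 0 ≤ s → ∀ (φ : C(Icc (-q) 0, ℝ)) (x : ℝ → ℝ), IsSolution a r q s φ x →
    ∀ t, s ≤ t → |x t| ≤ K * ‖φ‖ * Real.exp (-σ * (t - s))

/-- `[t]_h = [t / h] h`. -/
def gridFloor (h t : ℝ) : ℝ := (⌊t / h⌋ : ℝ) * h

/-- The piecewise constant argument `[t - [r([t]_h)]_h]_h`. -/
def gridArg (r : ℝ → ℝ) (h t : ℝ) : ℝ :=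
  gridFloor h (t - gridFloor h (r (gridFloor h t)))

/-- `z` is a solution of `z'(t) = -a(t) z([t - [r([t]_h)]_h]_h)`, with `z(nh) = φ(nh)` at the grid
points `nh` of `[-q, 0]`: it is continuous on `[0, ∞)`, its derivative exists except possibly at
the grid points, where it has finite one-sided derivatives, and it satisfies the equation on every
interval `[jh, (j + 1)h)` (with the right-hand derivative at `jh`). Only the values of `z` on
`[0, ∞)` and at the grid points of `[-q, 0]` matter. -/
structure IsPiecewiseSolution (a r : ℝ → ℝ) (q h : ℝ) (φ : C(Icc (-q) 0, ℝ)) (z : ℝ → ℝ) :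
    Prop where
  initial : ∀ (n : ℤ) (hn : (n : ℝ) * h ∈ Icc (-q) 0), z (n * h) = φ ⟨n * h, hn⟩
  continuousOn : ContinuousOn z (Ici 0)
  equation : ∀ (j : ℕ) (t : ℝ), t ∈ Ioo (j * h) ((j + 1) * h) →
    HasDerivAt z (-a t * z (gridArg r h t)) t
  equation_right : ∀ j : ℕ,
    HasDerivWithinAt z (-a (j * h) * z (gridArg r h (j * h))) (Ici (j * h)) (j * h)
  derivative_left : ∀ j : ℕ, 0 < j → ∃ d : ℝ, HasDerivWithinAt z d (Iic (j * h)) (j * h)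

/-- `w_r(ℓ) = sup {|r(t₂) - r(t₁)| : t₁, t₂ ≥ 0, |t₂ - t₁| ≤ ℓ}`. -/
def modulus (r : ℝ → ℝ) (l : ℝ) : ℝ :=
  sSup {y | ∃ t₁ t₂ : ℝ, 0 ≤ t₁ ∧ 0 ≤ t₂ ∧ |t₂ - t₁| ≤ l ∧ y = |r t₂ - r t₁|}

/-- `a₀ = sup {|a(t)| : t ≥ 0}`. -/
def supAbs (a : ℝ → ℝ) : ℝ := sSup ((fun t => |a t|) '' Ici 0)

/-- `‖f_t‖_q = sup {|f(t + θ)| : -q ≤ θ ≤ 0}`. -/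
def segmentNorm (q : ℝ) (f : ℝ → ℝ) (t : ℝ) : ℝ :=
  sSup ((fun θ => |f (t + θ)|) '' Icc (-q) 0)

/-- `K₁(h) = a₀² (2h + w_r(h)) K`. -/
def errorCoeff (a r : ℝ → ℝ) (K h : ℝ) : ℝ :=
  supAbs a ^ 2 * (2 * h + modulus r h) * K

/-- `t₀ = 3q + w_r(q)`. -/
def startTime (r : ℝ → ℝ) (q : ℝ) : ℝ := 3 * q + modulus r q

end DelayEq

end

namespace DelayEq

/-! By linearity, uniform asymptotic stability of (1) yields an exponential bound with constants
`K`, `σ`. On a window of length `T`, a solution of the forced equation `y'(t) = -a(t) y(t - r(t)) +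
f(t)` differs from the unforced solution with the same initial segment by at most a constant times
`sup |f|`, by Grönwall (`abs_le_of_forced`). If `T` is so long that the unforced part shrinks to a
quarter at the end of the window, forcing of size `2^{-n}` on the `n`-th window makes `y` decay at
the same rate (`abs_le_exp_of_forced`).

The window comparison is applied to `z_h` and to the error. `z_h` solves the forced equation with
`f(t) = -a(t) (z(gridArg r h t) - z(t - r(t)))`. The two arguments differ by at most `2h + w_r(h)`
and `z_h` has slope at most `a₀ sup |z|`, so `|f|` is at most `a₀² (2h + w_r(h))` times the recent
supremum of `|z|`. For small `h` this is absorbed, and `z_h` decays at a rate independent of `h`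
(`IsPiecewiseSolution.abs_le_exp`). The error `x - z_h` solves the forced equation with `-f`, which
is now known to be of order `K₁(h) ‖φ‖` and to decay at that rate. -/

/-! ### Grönwall estimate with delay. -/

/-- A Grönwall bound for functions whose right derivative is controlled by their own history: the
history before `s` is bounded by `C`. -/
theorem abs_le_of_abs_deriv_right_le_history {D d : ℝ → ℝ} {s b A C F : ℝ} (hsb : s ≤ b)
    (hA : 0 ≤ A) (hF : 0 ≤ F) (hD : ContinuousOn D (Icc s b))
    (hd : ∀ t ∈ Ico s b, HasDerivWithinAt D (d t) (Ici t) t) (hDs : |D s| ≤ C)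
    (hbound : ∀ t ∈ Ico s b, |d t| ≤ A * C + F ∨ ∃ u ∈ Icc s t, |d t| ≤ A * |D u| + F) :
    ∀ t ∈ Icc s b, |D t| ≤ 2 * (C + F * (b - s)) * Real.exp ((2 * A + 1) * (t - s)) := by
  have hC : 0 ≤ C := (abs_nonneg _).trans hDs
  -- With this exponent `A / l ≤ 1 / 2`, so the weighted maximum `M` below is bounded by the data
  -- plus `M / 2`.
  set l : ℝ := 2 * A + 1 with hl
  have hlpos : 0 < l := by positivity
  obtain ⟨m, hm, hmax⟩ := isCompact_Icc.exists_isMaxOn (nonempty_Icc.2 hsb)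
    (f := fun t => |D t| * Real.exp (-(l * (t - s))))
    (hD.abs.mul (by fun_prop))
  set M : ℝ := max (|D m| * Real.exp (-(l * (m - s)))) C with hM
  have hM0 : 0 ≤ M := hC.trans (le_max_right _ _)
  have hDM : ∀ t ∈ Icc s b, |D t| ≤ M * Real.exp (l * (t - s)) := by
    intro t ht
    have h1 : |D t| * Real.exp (-(l * (t - s))) ≤ M := (hmax ht).trans (le_max_left _ _)
    rw [Real.exp_neg, ← div_eq_mul_inv, div_le_iff₀ (Real.exp_pos _)] at h1
    exact h1
  have hdM : ∀ t ∈ Ico s b, |d t| ≤ A * M * Real.exp (l * (t - s)) + F := by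
    intro t ht
    have he : 1 ≤ Real.exp (l * (t - s)) :=
      Real.one_le_exp (mul_nonneg hlpos.le (sub_nonneg.2 ht.1))
    rcases hbound t ht with h | ⟨u, hu, h⟩
    · refine h.trans ?_
      have h1 : C ≤ M := le_max_right _ _
      have h2 : A * C ≤ A * M := by gcongr
      have h3 : A * M * 1 ≤ A * M * Real.exp (l * (t - s)) := by gcongr
      linarith
    · refine h.trans ?_
      have h1 := hDM u ⟨hu.1, hu.2.trans ht.2.le⟩
      have h2 : Real.exp (l * (u - s)) ≤ Real.exp (l * (t - s)) := by
        have := hu.2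
        gcongr
      have h3 : A * |D u| ≤ A * (M * Real.exp (l * (t - s))) := by
        have := h1.trans (mul_le_mul_of_nonneg_left h2 hM0)
        gcongr
      linarith
  have hB : ∀ t ∈ Icc s b,
      |D t| ≤ C + A * M / l * (Real.exp (l * (t - s)) - 1) + F * (t - s) := by
    have := image_norm_le_of_norm_deriv_right_le_deriv_boundary (f := D) (f' := d) (a := s)
      (b := b) (B := fun t => C + A * M / l * (Real.exp (l * (t - s)) - 1) + F * (t - s))
      (B' := fun t => A * M * Real.exp (l * (t - s)) + F) hD hd (by simpa using hDs)
      (fun t => by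
        have h1 : HasDerivAt (fun t => l * (t - s)) l t := by
          simpa using ((hasDerivAt_id t).sub_const s).const_mul l
        have h2 := (((h1.exp.sub_const 1).const_mul (A * M / l)).const_add C).add
          (((hasDerivAt_id t).sub_const s).const_mul F)
        exact h2.congr_deriv (by field_simp))
      (fun t ht => by simpa using hdM t ht)
    intro t ht
    simpa using this ht
  have hAl : A / l ≤ 1 / 2 := by
    rw [div_le_iff₀ hlpos, hl]; linarith
  have hexp : ∀ t ∈ Icc s b,
      |D t| ≤ (C + F * (b - s)) + M / 2 * Real.exp (l * (t - s)) := by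
    intro t ht
    refine (hB t ht).trans ?_
    have h1 : A * M / l * (Real.exp (l * (t - s)) - 1) ≤ M / 2 * Real.exp (l * (t - s)) := by
      have h3 : A * M / l ≤ M / 2 := by
        calc A * M / l = A / l * M := by ring
          _ ≤ 1 / 2 * M := by gcongr
          _ = M / 2 := by ring
      have h4 : 0 ≤ A * M / l := by positivity
      have h5 := mul_le_mul_of_nonneg_right h3 (Real.exp_pos (l * (t - s))).le
      nlinarith
    have h2 : F * (t - s) ≤ F * (b - s) := by
      have := ht.2
      gcongr
    linarith
  have hG : 0 ≤ F * (b - s) := mul_nonneg hF (sub_nonneg.2 hsb)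
  have hM2 : M ≤ 2 * (C + F * (b - s)) := by
    have h1 : M ≤ (C + F * (b - s)) + M / 2 := by
      refine max_le ?_ (by linarith)
      rw [Real.exp_neg, ← div_eq_mul_inv, div_le_iff₀ (Real.exp_pos _)]
      refine (hexp m hm).trans ?_
      have he : 1 ≤ Real.exp (l * (m - s)) :=
        Real.one_le_exp (mul_nonneg hlpos.le (sub_nonneg.2 hm.1))
      have : 0 ≤ C + F * (b - s) := by linarith
      nlinarith
    linarith
  intro t ht
  exact (hDM t ht).trans (by gcongr)

/-! ### Existence of solutions. -/

theorem abs_integral_le_of_abs_le_exp {g : ℝ → ℝ} {s m l B : ℝ} (hsm : s ≤ m)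
    (hl : 0 < l) (hB : 0 ≤ B) (hgB : ∀ t, s ≤ t → |g t| ≤ B * Real.exp (l * (t - s))) :
    |∫ t in s..m, g t| ≤ B / l * Real.exp (l * (m - s)) := by
  have h1 : ‖∫ t in s..m, g t‖ ≤ ∫ t in s..m, B * Real.exp (l * (t - s)) := by
    refine intervalIntegral.norm_integral_le_of_norm_le hsm ?_ ?_
    · exact Eventually.of_forall fun t ht => by simpa using hgB t ht.1.le
    · exact Continuous.intervalIntegrable (by fun_prop) _ _
  have h2 : ∫ t in s..m, B * Real.exp (l * (t - s))
      = B / l * Real.exp (l * (m - s)) - B / l * Real.exp (l * (s - s)) := by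
    refine intervalIntegral.integral_eq_sub_of_hasDerivAt
      (f := fun t => B / l * Real.exp (l * (t - s))) (fun t _ => ?_)
      (Continuous.intervalIntegrable (by fun_prop) _ _)
    have h1 : HasDerivAt (fun t => l * (t - s)) l t := by
      simpa using ((hasDerivAt_id t).sub_const s).const_mul l
    exact (h1.exp.const_mul (B / l)).congr_deriv (by field_simp)
  rw [Real.norm_eq_abs] at h1
  have : 0 ≤ B / l * Real.exp (l * (s - s)) := by positivity
  linarith

/-- The integral equation `y(t) = ψ(t) - ∫_s^t α(ξ) y(ξ - ρ(ξ)) dξ` has a solution. -/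
theorem exists_integral_solution {α ρ ψ : ℝ → ℝ} {s A C : ℝ} (hα : Continuous α)
    (hρ : Continuous ρ) (hψ : Continuous ψ) (hαA : ∀ t, |α t| ≤ A) (hρ0 : ∀ t, 0 ≤ ρ t)
    (hψC : ∀ t, |ψ t| ≤ C) :
    ∃ y : ℝ → ℝ, Continuous y ∧
      ∀ t, y t = ψ t - ∫ ξ in s..max t s, α ξ * y (ξ - ρ ξ) := by
  have hA : 0 ≤ A := (abs_nonneg _).trans (hαA 0)
  set l : ℝ := 2 * A + 1 with hl
  have hlpos : 0 < l := by positivity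
  have hAl : A / l ≤ 1 / 2 := by
    rw [div_le_iff₀ hlpos, hl]; linarith
  -- The unknown is written as `y(t) = exp(l (max t s - s)) u(t)` with `u` bounded. The sup norm of
  -- `u` is a weighted norm of `y` in which the integral operator has norm at most `A / l ≤ 1 / 2`,
  -- so one contraction covers all of `[s, ∞)`.
  let g : (ℝ → ℝ) → ℝ → ℝ := fun u ξ =>
    α ξ * (Real.exp (l * (max (ξ - ρ ξ) s - s)) * u (ξ - ρ ξ))
  have hg : ∀ u : ℝ → ℝ, Continuous u → Continuous (g u) := fun u hu => by
    simp only [g]; fun_prop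
  have hgB : ∀ (u : ℝ → ℝ) (B : ℝ), 0 ≤ B → (∀ t, |u t| ≤ B) → ∀ t, s ≤ t →
      |g u t| ≤ A * B * Real.exp (l * (t - s)) := by
    intro u B hB hu t ht
    have h1 : Real.exp (l * (max (t - ρ t) s - s)) ≤ Real.exp (l * (t - s)) := by
      have : max (t - ρ t) s ≤ t := max_le (by linarith [hρ0 t]) ht
      gcongr
    simp only [g]
    rw [abs_mul, abs_mul, Real.abs_exp]
    calc |α t| * (Real.exp (l * (max (t - ρ t) s - s)) * |u (t - ρ t)|)
        ≤ A * (Real.exp (l * (t - s)) * B) := by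
          gcongr
          · exact hαA t
          · exact hu _
      _ = _ := by ring
  have hint : ∀ (u : ℝ → ℝ) (B : ℝ), 0 ≤ B → (∀ t, |u t| ≤ B) → ∀ t,
      Real.exp (-(l * (max t s - s))) * |∫ ξ in s..max t s, g u ξ| ≤ B / 2 := by
    intro u B hB huB t
    have h1 := abs_integral_le_of_abs_le_exp (le_max_right t s) hlpos
      (mul_nonneg hA hB) (hgB u B hB huB)
    rw [Real.exp_neg, inv_mul_le_iff₀ (Real.exp_pos _)]
    calc _ ≤ A * B / l * Real.exp (l * (max t s - s)) := h1
      _ = A / l * (B * Real.exp (l * (max t s - s))) := by ring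
      _ ≤ 1 / 2 * (B * Real.exp (l * (max t s - s))) := by gcongr
      _ = Real.exp (l * (max t s - s)) * (B / 2) := by ring
  let Φ : (ℝ → ℝ) → ℝ → ℝ := fun u t =>
    Real.exp (-(l * (max t s - s))) * (ψ t - ∫ ξ in s..max t s, g u ξ)
  have hΦc : ∀ u : ℝ → ℝ, Continuous u → Continuous (Φ u) := by
    intro u hu
    have h1 : Continuous fun m => ∫ ξ in s..m, g u ξ :=
      intervalIntegral.continuous_primitive (fun _ _ => (hg u hu).intervalIntegrable _ _) s
    have h2 : Continuous fun t => ∫ ξ in s..max t s, g u ξ :=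
      h1.comp (continuous_id.max continuous_const)
    simp only [Φ]
    fun_prop
  have hC : 0 ≤ C := (abs_nonneg _).trans (hψC 0)
  have hΦb : ∀ (u : ℝ → ℝ) (B : ℝ), 0 ≤ B → (∀ t, |u t| ≤ B) →
      ∀ t, ‖Φ u t‖ ≤ C + B / 2 := by
    intro u B hB huB t
    have h1 := hint u B hB huB t
    have h2 : Real.exp (-(l * (max t s - s))) ≤ 1 := by
      rw [Real.exp_le_one_iff, neg_nonpos]
      exact mul_nonneg hlpos.le (sub_nonneg.2 (le_max_right _ _))
    simp only [Φ]
    rw [Real.norm_eq_abs, abs_mul, Real.abs_exp]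
    calc _ ≤ Real.exp (-(l * (max t s - s))) * (|ψ t| + |∫ ξ in s..max t s, g u ξ|) := by
          gcongr; exact abs_sub _ _
      _ = Real.exp (-(l * (max t s - s))) * |ψ t|
          + Real.exp (-(l * (max t s - s))) * |∫ ξ in s..max t s, g u ξ| := by ring
      _ ≤ 1 * C + B / 2 := by
          gcongr
          exact hψC t
      _ = _ := by ring
  let Ψ : BoundedContinuousFunction ℝ ℝ → BoundedContinuousFunction ℝ ℝ := fun u =>
    BoundedContinuousFunction.ofNormedAddCommGroup (Φ u) (hΦc u u.continuous) (C + ‖u‖ / 2)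
      (hΦb u ‖u‖ (norm_nonneg _) fun t => by
        simpa using u.norm_coe_le_norm t)
  have hΨ : ContractingWith (1 / 2) Ψ := by
    refine ⟨by rw [div_lt_one] <;> norm_num, LipschitzWith.of_dist_le_mul fun u v => ?_⟩
    rw [BoundedContinuousFunction.dist_le (by positivity)]
    intro t
    have h1 : Ψ u t - Ψ v t
        = -(Real.exp (-(l * (max t s - s))) * ∫ ξ in s..max t s, g (fun τ => u τ - v τ) ξ) := by
      have h2 : ∫ ξ in s..max t s, g (fun τ => u τ - v τ) ξ
          = (∫ ξ in s..max t s, g u ξ) - ∫ ξ in s..max t s, g v ξ := by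
        rw [← intervalIntegral.integral_sub ((hg u u.continuous).intervalIntegrable _ _)
          ((hg v v.continuous).intervalIntegrable _ _)]
        congr 1
        funext ξ
        simp only [g]
        ring
      rw [h2]
      simp only [Ψ, Φ, BoundedContinuousFunction.coe_ofNormedAddCommGroup]
      ring
    rw [Real.dist_eq, h1, abs_neg, abs_mul, Real.abs_exp]
    have h3 := hint (fun τ => u τ - v τ) (dist u v) dist_nonneg (fun τ => by
      simpa [Real.dist_eq] using BoundedContinuousFunction.dist_coe_le_dist (f := u) (g := v) τ) t
    refine h3.trans (le_of_eq ?_)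
    simp
    ring
  let u := hΨ.fixedPoint Ψ
  have hu : ∀ t, u t = Φ u t := fun t => by
    have h := hΨ.fixedPoint_isFixedPt
    exact (congrArg (fun f : BoundedContinuousFunction ℝ ℝ => f t) h).symm
  refine ⟨fun t => Real.exp (l * (max t s - s)) * u t, ?_, fun t => ?_⟩
  · have := u.continuous
    fun_prop
  · simp only
    rw [hu t]
    simp only [Φ]
    rw [← mul_assoc, ← Real.exp_add, add_neg_cancel, Real.exp_zero, one_mul]

/-- `ExponentialEstimate` speaks only of given solutions, while the window comparison needs one with
a prescribed initial segment. Extending `a`, `r` and `φ` by constants reduces this to the integral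
equation on the whole line. -/
theorem exists_isSolution {a r : ℝ → ℝ} {q A s : ℝ} (ha : ContinuousOn a (Ici 0))
    (hr : ContinuousOn r (Ici 0)) (hq : 0 ≤ q) (haA : ∀ t, 0 ≤ t → |a t| ≤ A)
    (hr0 : ∀ t, 0 ≤ t → 0 ≤ r t) (hs : 0 ≤ s) (φ : C(Icc (-q) 0, ℝ)) :
    ∃ x, IsSolution a r q s φ x := by
  have hq' : -q ≤ 0 := by linarith
  have hmax : ∀ {f : ℝ → ℝ}, ContinuousOn f (Ici 0) → Continuous fun t => f (max t 0) :=
    fun hf => hf.comp_continuous (by fun_prop) fun t => mem_Ici.2 (le_max_right _ _)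
  have hψ : Continuous fun t => φ (projIcc (-q) 0 hq' (t - s)) :=
    φ.continuous.comp (continuous_projIcc.comp (by fun_prop))
  obtain ⟨y, hyc, hy⟩ := exists_integral_solution (s := s) (C := ‖φ‖) (hmax ha) (hmax hr) hψ
    (fun t => haA _ (le_max_right _ _)) (fun t => hr0 _ (le_max_right _ _))
    (fun t => φ.norm_coe_le_norm _)
  refine ⟨y, hyc.continuousOn, fun θ => ?_, fun t ht => ?_⟩
  · rw [hy, max_eq_right (by linarith [θ.2.2]), intervalIntegral.integral_same, sub_zero,
      add_sub_cancel_left, projIcc_val]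
  · have h0 : 0 ≤ t := hs.trans ht
    have hc : Continuous fun ξ => a (max ξ 0) * y (ξ - r (max ξ 0)) :=
      (hmax ha).mul (hyc.comp (continuous_id.sub (hmax hr)))
    have h1 : HasDerivAt (fun m => φ ⟨0, hq', le_rfl⟩ -
        ∫ ξ in s..m, a (max ξ 0) * y (ξ - r (max ξ 0)))
        (-(a (max t 0) * y (t - r (max t 0)))) t :=
      (intervalIntegral.integral_hasDerivAt_right (hc.intervalIntegrable _ _)
        (hc.stronglyMeasurableAtFilter _ _) hc.continuousAt).const_sub _
    rw [max_eq_left h0] at h1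
    rw [neg_mul]
    have heq : ∀ u, s ≤ u → y u = φ ⟨0, hq', le_rfl⟩ -
        ∫ ξ in s..u, a (max ξ 0) * y (ξ - r (max ξ 0)) := fun u hu => by
      rw [hy u, max_eq_left hu, projIcc_of_right_le hq' (sub_nonneg.2 hu)]
    exact h1.hasDerivWithinAt.congr (fun u hu => heq u (ht.trans hu)) (heq t ht)

/-! ### From uniform asymptotic stability to an exponential estimate. -/

/-- Geometric decay along windows of length `T` is exponential decay. -/
theorem le_exp_of_le_half_pow {v : ℝ → ℝ} {s T B : ℝ} (hT : 0 < T) (hB : 0 ≤ B)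
    (hv : ∀ n : ℕ, ∀ t ∈ Icc (s + n * T) (s + (n + 1) * T), v t ≤ B * (1 / 2) ^ n) :
    ∀ t, s ≤ t → v t ≤ 2 * B * Real.exp (-(Real.log 2 / T) * (t - s)) := by
  intro t ht
  set n := ⌊(t - s) / T⌋₊
  have h0 : 0 ≤ (t - s) / T := div_nonneg (sub_nonneg.2 ht) hT.le
  have h1 : (n : ℝ) * T ≤ t - s := (le_div_iff₀ hT).1 (Nat.floor_le h0)
  have h2 : (t - s) / T ≤ n + 1 := (Nat.lt_floor_add_one _).le
  refine (hv n t ⟨by linarith, by linarith [(div_le_iff₀ hT).1 h2]⟩).trans ?_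
  have h3 : ((1 : ℝ) / 2) ^ n = 2 * Real.exp (-Real.log 2 * (n + 1)) := by
    have h4 : Real.exp (-Real.log 2) = 1 / 2 := by
      rw [Real.exp_neg, Real.exp_log (by norm_num)]; norm_num
    have h5 : -Real.log 2 * ((n : ℝ) + 1) = ((n + 1 : ℕ) : ℝ) * (-Real.log 2) := by
      push_cast; ring
    rw [h5, Real.exp_nat_mul, h4, pow_succ]
    ring
  rw [h3]
  have h6 : Real.exp (-Real.log 2 * (n + 1)) ≤ Real.exp (-(Real.log 2 / T) * (t - s)) := by
    rw [Real.exp_le_exp]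
    have h7 : Real.log 2 * ((t - s) / T) ≤ Real.log 2 * (n + 1) :=
      mul_le_mul_of_nonneg_left h2 (Real.log_nonneg (by norm_num))
    have h8 : Real.log 2 / T * (t - s) = Real.log 2 * ((t - s) / T) := by ring
    linarith
  calc B * (2 * Real.exp (-Real.log 2 * (n + 1)))
      = 2 * B * Real.exp (-Real.log 2 * (n + 1)) := by ring
    _ ≤ _ := by gcongr

/-- The segment `θ ↦ x (s + θ)` of a function continuous on `[s - q, ∞)`. -/
def segment (q s : ℝ) (x : ℝ → ℝ) (hx : ContinuousOn x (Ici (s - q))) : C(Icc (-q) 0, ℝ) where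
  toFun θ := x (s + θ)
  continuous_toFun := hx.comp_continuous (by fun_prop) fun θ => by
    have := θ.2.1
    simp only [mem_Ici]
    linarith

theorem norm_segment_le {q s : ℝ} {x : ℝ → ℝ} (hx : ContinuousOn x (Ici (s - q))) {N : ℝ}
    (hN : 0 ≤ N) (h : ∀ t ∈ Icc (s - q) s, |x t| ≤ N) : ‖segment q s x hx‖ ≤ N :=
  (ContinuousMap.norm_le _ hN).2 fun θ =>
    h _ ⟨by linarith [θ.2.1], by linarith [θ.2.2]⟩

theorem IsSolution.restart {a r : ℝ → ℝ} {q s : ℝ} {φ : C(Icc (-q) 0, ℝ)} {x : ℝ → ℝ}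
    (h : IsSolution a r q s φ x) {s' : ℝ} (hs : s ≤ s') :
    IsSolution a r q s'
      (segment q s' x (h.continuousOn.mono (Ici_subset_Ici.2 (by linarith)))) x where
  continuousOn := h.continuousOn.mono (Ici_subset_Ici.2 (by linarith))
  initial _ := rfl
  equation t ht := h.equation t (hs.trans ht)

theorem IsSolution.const_mul {a r : ℝ → ℝ} {q s : ℝ} {φ : C(Icc (-q) 0, ℝ)} {x : ℝ → ℝ}
    (h : IsSolution a r q s φ x) (c : ℝ) :
    IsSolution a r q s (c • φ) (fun t => c * x t) where
  continuousOn := h.continuousOn.const_smul c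
  initial θ := by simp [h.initial θ]
  equation t ht := ((h.equation t ht).const_mul c).congr_deriv (by ring)

/-- By linearity, a bound on solutions with small initial value is a linear bound. -/
theorem abs_le_mul_norm_of_small {a r : ℝ → ℝ} {q s δ ε t : ℝ} (hδ : 0 < δ)
    (h : ∀ (φ : C(Icc (-q) 0, ℝ)) (x : ℝ → ℝ), IsSolution a r q s φ x → ‖φ‖ < δ → |x t| < ε)
    {φ : C(Icc (-q) 0, ℝ)} {x : ℝ → ℝ} (hx : IsSolution a r q s φ x) :
    |x t| ≤ 2 * ε / δ * ‖φ‖ := by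
  rcases (norm_nonneg φ).eq_or_lt with h0 | h0
  · rw [← h0, mul_zero]
    -- A zero initial value admits every multiple of `x`; the one of modulus `|ε|` at `t` violates
    -- the strict bound.
    by_contra! hlt
    have h1 := h _ _ (hx.const_mul (ε / |x t|)) (by rw [norm_smul, ← h0, mul_zero]; exact hδ)
    rw [abs_mul, abs_div, abs_abs, div_mul_cancel₀ _ hlt.ne'] at h1
    exact absurd (le_abs_self ε) (not_le.2 h1)
  · have hc : 0 < δ / (2 * ‖φ‖) := by positivity
    have h1 := h _ _ (hx.const_mul (δ / (2 * ‖φ‖))) (by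
      rw [norm_smul, Real.norm_of_nonneg hc.le]
      field_simp
      linarith)
    rw [abs_mul, abs_of_pos hc] at h1
    calc |x t| = 2 / δ * ‖φ‖ * (δ / (2 * ‖φ‖) * |x t|) := by field_simp
      _ ≤ 2 / δ * ‖φ‖ * ε := by gcongr
      _ = _ := by ring

/-- Scaling turns stability into a bound `2 / δ * ‖φ‖` for all times, and attraction into halving of
the norm after a fixed time. Restarting at the times `s + n T` iterates the halving. -/
theorem UniformlyAsymptoticallyStable.exists_exponentialEstimate {a r : ℝ → ℝ} {q : ℝ}
    (hq : 0 < q) (h : UniformlyAsymptoticallyStable a r q) :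
    ∃ K σ : ℝ, 0 < K ∧ 0 < σ ∧ ExponentialEstimate a r q K σ := by
  obtain ⟨hst, b, hb, hatt⟩ := h
  obtain ⟨δ, hδ, hst⟩ := hst 1 one_pos
  -- The level `b / 4` scales to the factor `2 (b / 4) / b = 1 / 2`. The extra `q` in `T` puts the
  -- whole segment ending at `s + T` beyond `s + T₀`.
  obtain ⟨T₀, hT₀, hatt⟩ := hatt (b / 4) (by positivity)
  set T := T₀ + q with hT
  have hTpos : 0 < T := by positivity
  refine ⟨2 * (2 / δ), Real.log 2 / T, by positivity,
    div_pos (Real.log_pos (by norm_num)) hTpos, ?_⟩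
  have hstable : ∀ s, 0 ≤ s → ∀ (φ : C(Icc (-q) 0, ℝ)) (x : ℝ → ℝ), IsSolution a r q s φ x →
      ∀ t, s ≤ t → |x t| ≤ 2 / δ * ‖φ‖ := fun s hs φ x hx t ht => by
    have := abs_le_mul_norm_of_small hδ (fun φ x hx hφ => hst s hs φ x hx hφ t ht) hx
    simpa using this
  have hhalf : ∀ s, 0 ≤ s → ∀ (φ : C(Icc (-q) 0, ℝ)) (x : ℝ → ℝ), IsSolution a r q s φ x →
      ∀ t, s + T₀ ≤ t → |x t| ≤ 1 / 2 * ‖φ‖ := fun s hs φ x hx t ht => by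
    have := abs_le_mul_norm_of_small hb (fun φ x hx hφ => hatt s hs φ x hx hφ t ht) hx
    have h2 : 2 * (b / 4) / b = 1 / 2 := by field_simp; norm_num
    rwa [h2] at this
  intro s hs φ x hx t ht
  have hcont : ∀ n : ℕ, s ≤ s + n * T := fun n => by
    have : 0 ≤ n * T := by positivity
    linarith
  have hseg : ∀ n : ℕ, ‖segment q (s + n * T) x
      (hx.continuousOn.mono (Ici_subset_Ici.2 (by linarith [hcont n])))‖
        ≤ ‖φ‖ * (1 / 2) ^ n := by
    intro n
    induction n with
    | zero =>
      refine norm_segment_le _ (by positivity) fun u hu => ?_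
      simp only [Nat.cast_zero, zero_mul, add_zero] at hu
      have h1 := hx.initial ⟨u - s, by linarith [hu.1], by linarith [hu.2]⟩
      simp only [add_sub_cancel] at h1
      rw [h1, pow_zero, mul_one]
      exact φ.norm_coe_le_norm _
    | succ n ih =>
      refine norm_segment_le _ (by positivity) fun u hu => ?_
      have h1 := hhalf _ (hs.trans (hcont n)) _ _ (hx.restart (hcont n)) u (by
        have := hu.1
        push_cast at this
        linarith)
      refine h1.trans ?_
      rw [pow_succ]
      linarith
  have := le_exp_of_le_half_pow (v := fun t => |x t|) (s := s) (B := 2 / δ * ‖φ‖) hTpos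
    (by positivity) (fun n u hu => by
      have h1 := hstable _ (hs.trans (hcont n)) _ _ (hx.restart (hcont n)) u hu.1
      refine h1.trans ?_
      rw [mul_assoc]
      exact mul_le_mul_of_nonneg_left (hseg n) (by positivity)) t ht
  calc |x t| ≤ _ := this
    _ = _ := by ring

/-! ### The forced equation on one window. -/

/-- On a window of length `T`, a solution of the forced equation is close to the solution of the
homogeneous equation with the same initial segment. -/
theorem abs_le_of_forced {a r f y : ℝ → ℝ} {q A K σ s T N F : ℝ} (ha : ContinuousOn a (Ici 0))
    (hr : ContinuousOn r (Ici 0)) (hq : 0 ≤ q) (haA : ∀ t, 0 ≤ t → |a t| ≤ A)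
    (hr0 : ∀ t, 0 ≤ t → 0 ≤ r t) (hrq : ∀ t, 0 ≤ t → r t ≤ q) (hK : 0 ≤ K)
    (hE : ExponentialEstimate a r q K σ) (hs : 0 ≤ s) (hT : 0 ≤ T) (hF : 0 ≤ F)
    (hyc : ContinuousOn y (Ici (s - q)))
    (hy : ∀ t, s ≤ t → HasDerivWithinAt y (-a t * y (t - r t) + f t) (Ici t) t)
    (hN : ∀ t ∈ Icc (s - q) s, |y t| ≤ N) (hf : ∀ t ∈ Icc s (s + T), |f t| ≤ F) :
    ∀ t ∈ Icc s (s + T), |y t| ≤ K * N * Real.exp (-σ * (t - s))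
      + 2 * T * Real.exp ((2 * A + 1) * T) * F := by
  have hA : 0 ≤ A := (abs_nonneg _).trans (haA 0 le_rfl)
  have hN0 : 0 ≤ N := (abs_nonneg _).trans (hN s ⟨by linarith, le_rfl⟩)
  obtain ⟨u, hu⟩ := exists_isSolution ha hr hq haA hr0 hs (segment q s y hyc)
  have hD0 : ∀ t ∈ Icc (s - q) s, y t - u t = 0 := by
    intro t ht
    have h1 := hu.initial ⟨t - s, by linarith [ht.1], by linarith [ht.2]⟩
    simp only [segment, ContinuousMap.coe_mk, add_sub_cancel] at h1
    rw [h1, sub_self]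
  have hsub : Icc s (s + T) ⊆ Ici (s - q) := fun t ht => by
    have := ht.1
    simp only [mem_Ici]
    linarith
  -- The difference has zero history, so only the forcing drives it.
  have hD := abs_le_of_abs_deriv_right_le_history (D := fun t => y t - u t)
    (d := fun t => -a t * (y (t - r t) - u (t - r t)) + f t) (s := s) (b := s + T) (A := A)
    (C := 0) (F := F) (by linarith) hA hF ((hyc.sub hu.continuousOn).mono hsub)
    (fun t ht => ((hy t ht.1).sub (hu.equation t ht.1)).congr_deriv (by ring))
    (by simp [hD0 s ⟨by linarith, le_rfl⟩])
    (fun t ht => by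
      have ht0 : 0 ≤ t := hs.trans ht.1
      have hft := hf t ⟨ht.1, ht.2.le⟩
      have hle : |-a t * (y (t - r t) - u (t - r t)) + f t|
          ≤ A * |y (t - r t) - u (t - r t)| + F := by
        refine (abs_add_le _ _).trans (add_le_add ?_ hft)
        rw [abs_mul, abs_neg]
        exact mul_le_mul_of_nonneg_right (haA t ht0) (abs_nonneg _)
      rcases le_total s (t - r t) with h | h
      · exact Or.inr ⟨t - r t, ⟨h, by linarith [hr0 t ht0]⟩, hle⟩
      · left
        have h0 := hD0 (t - r t) ⟨by linarith [hrq t ht0, ht.1], h⟩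
        exact hle.trans_eq (by rw [h0, abs_zero]))
  intro t ht
  have h1 := hE s hs _ u hu t ht.1
  have h2 : K * ‖segment q s y hyc‖ * Real.exp (-σ * (t - s))
      ≤ K * N * Real.exp (-σ * (t - s)) := by
    have := norm_segment_le hyc hN0 hN
    gcongr
  have h3 : |y t - u t| ≤ 2 * T * Real.exp ((2 * A + 1) * T) * F := by
    refine (hD t ht).trans ?_
    have h4 : Real.exp ((2 * A + 1) * (t - s)) ≤ Real.exp ((2 * A + 1) * T) := by
      have := ht.2
      gcongr
      linarith
    calc 2 * (0 + F * (s + T - s)) * Real.exp ((2 * A + 1) * (t - s))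
        = 2 * T * F * Real.exp ((2 * A + 1) * (t - s)) := by ring
      _ ≤ 2 * T * F * Real.exp ((2 * A + 1) * T) := by gcongr
      _ = _ := by ring
  have h5 : |y t| ≤ |u t| + |y t - u t| := by
    have := abs_add_le (u t) (y t - u t)
    rwa [add_sub_cancel] at this
  linarith

/-! ### Grid arguments and the modulus of continuity. -/

/-- Being an integer multiple of `h`, a delayed argument in `[-q, 0]` is a point where `z` is
prescribed by `φ`. -/
theorem gridArg_eq {r : ℝ → ℝ} {h t : ℝ} (hh : 0 < h) :
    gridArg r h t = ((⌊t / h⌋ - ⌊r (gridFloor h t) / h⌋ : ℤ) : ℝ) * h := by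
  unfold gridArg
  rw [gridFloor, gridFloor, sub_div, mul_div_cancel_right₀ _ hh.ne', Int.floor_sub_intCast]

theorem gridFloor_le {h : ℝ} (hh : 0 < h) (t : ℝ) : gridFloor h t ≤ t :=
  (le_div_iff₀ hh).1 (Int.floor_le _)

theorem lt_gridFloor_add {h : ℝ} (hh : 0 < h) (t : ℝ) : t < gridFloor h t + h := by
  have := (div_lt_iff₀ hh).1 (Int.lt_floor_add_one (t / h))
  unfold gridFloor
  linarith

theorem gridFloor_nonneg {h t : ℝ} (hh : 0 < h) (ht : 0 ≤ t) : 0 ≤ gridFloor h t := by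
  have : 0 ≤ ⌊t / h⌋ := Int.floor_nonneg.2 (by positivity)
  unfold gridFloor
  have : (0 : ℝ) ≤ ⌊t / h⌋ := by exact_mod_cast this
  positivity

theorem gridArg_eq_sub {r : ℝ → ℝ} {h t : ℝ} (hh : 0 < h) :
    gridArg r h t = gridFloor h t - gridFloor h (r (gridFloor h t)) := by
  rw [gridArg_eq hh]
  push_cast
  rw [sub_mul]
  rfl

section Modulus

variable {r : ℝ → ℝ} {q : ℝ}

theorem abs_sub_le_of_mem_Icc (hr0 : ∀ t, 0 ≤ t → 0 ≤ r t) (hrq : ∀ t, 0 ≤ t → r t ≤ q)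
    {t₁ t₂ : ℝ} (h₁ : 0 ≤ t₁) (h₂ : 0 ≤ t₂) : |r t₂ - r t₁| ≤ q := by
  rw [abs_le]
  constructor <;> linarith [hr0 _ h₁, hr0 _ h₂, hrq _ h₁, hrq _ h₂]

theorem abs_sub_le_modulus (hr0 : ∀ t, 0 ≤ t → 0 ≤ r t) (hrq : ∀ t, 0 ≤ t → r t ≤ q)
    {t₁ t₂ l : ℝ} (h₁ : 0 ≤ t₁) (h₂ : 0 ≤ t₂) (hl : |t₂ - t₁| ≤ l) :
    |r t₂ - r t₁| ≤ modulus r l := by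
  refine le_csSup ⟨q, ?_⟩ ⟨t₁, t₂, h₁, h₂, hl, rfl⟩
  rintro _ ⟨u, v, hu, hv, -, rfl⟩
  exact abs_sub_le_of_mem_Icc hr0 hrq hu hv

theorem modulus_nonneg (l : ℝ) : 0 ≤ modulus r l := by
  refine Real.sSup_nonneg ?_
  rintro _ ⟨u, v, hu, hv, -, rfl⟩
  exact abs_nonneg _

theorem tendsto_modulus (hr : UniformContinuousOn r (Ici 0)) :
    Tendsto (modulus r) (𝓝[>] 0) (𝓝 0) := by
  rw [Metric.tendsto_nhds]
  intro ε hε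
  obtain ⟨δ, hδ, hr⟩ := Metric.uniformContinuousOn_iff.1 hr (ε / 2) (half_pos hε)
  filter_upwards [Ioo_mem_nhdsGT hδ] with l hl
  rw [Real.dist_eq, sub_zero, abs_of_nonneg (modulus_nonneg l)]
  refine lt_of_le_of_lt (Real.sSup_le ?_ (half_pos hε).le) (half_lt_self hε)
  rintro _ ⟨u, v, hu, hv, huv, rfl⟩
  exact (hr v hv u hu (by rw [Real.dist_eq]; linarith [hl.2])).le

theorem tendsto_errorCoeff (a : ℝ → ℝ) (hr : UniformContinuousOn r (Ici 0)) (K : ℝ) :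
    Tendsto (errorCoeff a r K) (𝓝[>] 0) (𝓝 0) := by
  have h1 : Tendsto (fun h : ℝ => h) (𝓝[>] 0) (𝓝 0) :=
    tendsto_nhdsWithin_of_tendsto_nhds tendsto_id
  have h2 := (((h1.const_mul 2).add (tendsto_modulus hr)).const_mul (supAbs a ^ 2)).mul_const K
  simp only [mul_zero, add_zero, zero_mul] at h2
  exact h2

/-- Each of the two roundings costs at most `h`, and sampling `r` at `[t]_h` costs at most `w_r(h)`.
-/
theorem abs_sub_gridArg_le (hr0 : ∀ t, 0 ≤ t → 0 ≤ r t) (hrq : ∀ t, 0 ≤ t → r t ≤ q) {h t : ℝ}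
    (hh : 0 < h) (ht : 0 ≤ t) : |gridArg r h t - (t - r t)| ≤ 2 * h + modulus r h := by
  have h1 := gridFloor_le hh t
  have h2 := lt_gridFloor_add hh t
  have h3 := gridFloor_le hh (r (gridFloor h t))
  have h4 := lt_gridFloor_add hh (r (gridFloor h t))
  have h5 := abs_le.1 (abs_sub_le_modulus hr0 hrq (gridFloor_nonneg hh ht) ht
    (l := h) (by rw [abs_le]; constructor <;> linarith))
  rw [gridArg_eq_sub hh, abs_le]
  constructor <;> linarith [h5.1, h5.2]

theorem gridArg_le (hr0 : ∀ t, 0 ≤ t → 0 ≤ r t) {h t : ℝ} (hh : 0 < h) (ht : 0 ≤ t) :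
    gridArg r h t ≤ t := by
  rw [gridArg_eq_sub hh]
  linarith [gridFloor_le hh t, gridFloor_nonneg hh (hr0 _ (gridFloor_nonneg hh ht))]

theorem sub_le_gridArg (hrq : ∀ t, 0 ≤ t → r t ≤ q) {h t : ℝ} (hh : 0 < h) (ht : 0 ≤ t) :
    t - q - h ≤ gridArg r h t := by
  rw [gridArg_eq_sub hh]
  linarith [lt_gridFloor_add hh t, gridFloor_le hh (r (gridFloor h t)),
    hrq _ (gridFloor_nonneg hh ht)]

theorem neg_le_gridArg (hrq : ∀ t, 0 ≤ t → r t ≤ q) {h t : ℝ} (hh : 0 < h) (ht : 0 ≤ t) :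
    -q ≤ gridArg r h t := by
  rw [gridArg_eq_sub hh]
  linarith [gridFloor_nonneg hh ht, gridFloor_le hh (r (gridFloor h t)),
    hrq _ (gridFloor_nonneg hh ht)]

end Modulus

/-! ### Decaying forcing over successive windows. -/

/-- Solutions of the forced equation decay exponentially if the forcing term does. -/
theorem abs_le_exp_of_forced {a r f y : ℝ → ℝ} {q A K σ s T N F : ℝ}
    (ha : ContinuousOn a (Ici 0)) (hr : ContinuousOn r (Ici 0)) (hq : 0 ≤ q)
    (haA : ∀ t, 0 ≤ t → |a t| ≤ A) (hr0 : ∀ t, 0 ≤ t → 0 ≤ r t) (hrq : ∀ t, 0 ≤ t → r t ≤ q)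
    (hK : 0 ≤ K) (hσ : 0 ≤ σ) (hE : ExponentialEstimate a r q K σ) (hs : 0 ≤ s) (hT : 0 < T)
    (hqT : q ≤ T) (hKT : K * Real.exp (-σ * (T - q)) ≤ 1 / 4) (hF : 0 ≤ F)
    (hyc : ContinuousOn y (Ici (s - q)))
    (hy : ∀ t, s ≤ t → HasDerivWithinAt y (-a t * y (t - r t) + f t) (Ici t) t)
    (hN : ∀ t ∈ Icc (s - q) s, |y t| ≤ N)
    (hf : ∀ n : ℕ, ∀ t ∈ Icc (s + n * T) (s + (n + 1) * T), |f t| ≤ F * (1 / 2) ^ n) :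
    ∀ t, s ≤ t → |y t| ≤ 2 * (K * N + (4 * K + 1) * (2 * T * Real.exp ((2 * A + 1) * T)) * F)
      * Real.exp (-(Real.log 2 / T) * (t - s)) := by
  have hN0 : 0 ≤ N := (abs_nonneg _).trans (hN s ⟨by linarith, le_rfl⟩)
  set c : ℝ := 2 * T * Real.exp ((2 * A + 1) * T)
  have hc : 0 ≤ c := by positivity
  have hle : ∀ n : ℕ, s ≤ s + n * T := fun n => by
    have : 0 ≤ n * T := by positivity
    linarith
  have hwin : ∀ (n : ℕ) (B : ℝ), (∀ t ∈ Icc (s + n * T - q) (s + n * T), |y t| ≤ B) →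
      ∀ t ∈ Icc (s + n * T) (s + n * T + T), |y t|
        ≤ K * B * Real.exp (-σ * (t - (s + n * T))) + c * (F * (1 / 2) ^ n) := fun n B hB =>
    abs_le_of_forced ha hr hq haA hr0 hrq hK hE (hs.trans (hle n)) hT.le (by positivity)
      (hyc.mono (Ici_subset_Ici.2 (by linarith [hle n])))
      (fun t ht => hy t ((hle n).trans ht)) hB
      (fun t ht => hf n t ⟨ht.1, by linarith [ht.2]⟩)
  -- The summand `4 c F` is the one that reproduces itself: a quarter of it plus `c F` is half of
  -- it.
  have hseg : ∀ n : ℕ, ∀ t ∈ Icc (s + n * T - q) (s + n * T),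
      |y t| ≤ (N + 4 * c * F) * (1 / 2) ^ n := by
    intro n
    induction n with
    | zero =>
      intro t ht
      simp only [Nat.cast_zero, zero_mul, add_zero] at ht
      have : 0 ≤ 4 * c * F := by positivity
      linarith [hN t ht]
    | succ n ih =>
      intro t ht
      push_cast at ht
      have h1 := hwin n _ ih t ⟨by linarith [ht.1], by linarith [ht.2]⟩
      refine h1.trans ?_
      have h2 : K * Real.exp (-σ * (t - (s + n * T))) ≤ 1 / 4 := by
        refine le_trans (mul_le_mul_of_nonneg_left (Real.exp_le_exp.2 ?_) hK) hKT
        have : σ * (T - q) ≤ σ * (t - (s + n * T)) :=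
          mul_le_mul_of_nonneg_left (by linarith [ht.1]) hσ
        linarith
      have h3 : 0 ≤ (N + 4 * c * F) * (1 / 2) ^ n := by positivity
      have h4 := mul_le_mul_of_nonneg_right h2 h3
      have h5 : 0 ≤ N * (1 / 2) ^ n := by positivity
      rw [pow_succ]
      nlinarith
  refine le_exp_of_le_half_pow (v := fun t => |y t|) hT (by positivity) fun n t ht => ?_
  have h1 := hwin n _ (hseg n) t ⟨ht.1, by linarith [ht.2]⟩
  refine h1.trans ?_
  have h2 : Real.exp (-σ * (t - (s + n * T))) ≤ 1 := by
    rw [Real.exp_le_one_iff]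
    have : 0 ≤ σ * (t - (s + n * T)) := mul_nonneg hσ (sub_nonneg.2 ht.1)
    linarith
  have h3 : 0 ≤ K * ((N + 4 * c * F) * (1 / 2) ^ n) := by positivity
  have h4 := mul_le_mul_of_nonneg_left h2 h3
  refine (add_le_add_left h4 _).trans (le_of_eq ?_)
  ring

/-! ### Decay of the piecewise solutions, uniformly in the step size. -/

section Piecewise

variable {a r z : ℝ → ℝ} {q h A : ℝ} {φ : C(Icc (-q) 0, ℝ)}

theorem IsPiecewiseSolution.hasDerivWithinAt (hz : IsPiecewiseSolution a r q h φ z) (hh : 0 < h)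
    {t : ℝ} (ht : 0 ≤ t) : HasDerivWithinAt z (-a t * z (gridArg r h t)) (Ici t) t := by
  have h1 : (⌊t / h⌋₊ : ℝ) * h ≤ t := (le_div_iff₀ hh).1 (Nat.floor_le (by positivity))
  have h2 : t < (⌊t / h⌋₊ + 1 : ℝ) * h := (div_lt_iff₀ hh).1 (Nat.lt_floor_add_one _)
  rcases h1.eq_or_lt with h3 | h3
  · have := hz.equation_right ⌊t / h⌋₊
    rwa [h3] at this
  · exact (hz.equation _ t ⟨h3, h2⟩).hasDerivWithinAt

theorem IsPiecewiseSolution.abs_gridArg_le_norm (hz : IsPiecewiseSolution a r q h φ z)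
    (hrq : ∀ t, 0 ≤ t → r t ≤ q) (hh : 0 < h) {t : ℝ} (ht : 0 ≤ t) (hg : gridArg r h t ≤ 0) :
    |z (gridArg r h t)| ≤ ‖φ‖ := by
  have h1 := neg_le_gridArg hrq hh ht
  rw [gridArg_eq hh] at h1 hg ⊢
  rw [hz.initial _ ⟨h1, hg⟩]
  exact φ.norm_coe_le_norm _

theorem abs_neg_mul_le (haA : ∀ t, 0 ≤ t → |a t| ≤ A) {t : ℝ} (ht : 0 ≤ t) (v : ℝ) :
    |-a t * v| ≤ A * |v| := by
  rw [abs_mul, abs_neg]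
  exact mul_le_mul_of_nonneg_right (haA t ht) (abs_nonneg _)

/-- The history enters only through the delayed values actually used, so the bound serves both `s =
0`, where they come from `φ`, and later `s`, where they are values of `z` itself. -/
theorem IsPiecewiseSolution.abs_le_of_history (hz : IsPiecewiseSolution a r q h φ z)
    (haA : ∀ t, 0 ≤ t → |a t| ≤ A) (hr0 : ∀ t, 0 ≤ t → 0 ≤ r t) (hh : 0 < h) {s T C : ℝ}
    (hs : 0 ≤ s) (hT : 0 ≤ T) (hsC : |z s| ≤ C)
    (hC : ∀ t, s ≤ t → gridArg r h t ≤ s → |z (gridArg r h t)| ≤ C) :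
    ∀ t ∈ Icc s (s + T), |z t| ≤ 2 * Real.exp ((2 * A + 1) * T) * C := by
  have hA : 0 ≤ A := (abs_nonneg _).trans (haA 0 le_rfl)
  have hC0 : 0 ≤ C := (abs_nonneg _).trans hsC
  intro t ht
  have h1 := abs_le_of_abs_deriv_right_le_history (D := z)
    (d := fun t => -a t * z (gridArg r h t)) (s := s) (b := s + T) (A := A) (C := C) (F := 0)
    (by linarith) hA le_rfl
    (hz.continuousOn.mono fun u hu => mem_Ici.2 (hs.trans hu.1))
    (fun u hu => hz.hasDerivWithinAt hh (hs.trans hu.1)) hsC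
    (fun u hu => by
      have h2 := abs_neg_mul_le haA (hs.trans hu.1) (z (gridArg r h u))
      rcases le_total (gridArg r h u) s with h3 | h3
      · left
        have := mul_le_mul_of_nonneg_left (hC u hu.1 h3) hA
        linarith
      · exact Or.inr ⟨_, ⟨h3, gridArg_le hr0 hh (hs.trans hu.1)⟩, by linarith⟩) t ht
  refine h1.trans ?_
  have h4 : Real.exp ((2 * A + 1) * (t - s)) ≤ Real.exp ((2 * A + 1) * T) := by
    have := ht.2
    gcongr
    linarith
  calc _ = 2 * C * Real.exp ((2 * A + 1) * (t - s)) := by ring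
    _ ≤ 2 * C * Real.exp ((2 * A + 1) * T) := by gcongr
    _ = _ := by ring

/-- The difference of `z` at the two delayed arguments is small. -/
theorem IsPiecewiseSolution.abs_sub_le (hz : IsPiecewiseSolution a r q h φ z)
    (haA : ∀ t, 0 ≤ t → |a t| ≤ A) (hr0 : ∀ t, 0 ≤ t → 0 ≤ r t) (hrq : ∀ t, 0 ≤ t → r t ≤ q)
    (hh : 0 < h) (hhq : h ≤ q) {t B : ℝ} (ht : 2 * q ≤ t)
    (hB : ∀ ξ ∈ Icc (t - 2 * q) t, |z (gridArg r h ξ)| ≤ B) :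
    |z (gridArg r h t) - z (t - r t)| ≤ A * B * (2 * h + modulus r h) := by
  have hA : 0 ≤ A := (abs_nonneg _).trans (haA 0 le_rfl)
  have ht0 : 0 ≤ t := by linarith
  have hB0 : 0 ≤ B := (abs_nonneg _).trans (hB t ⟨by linarith, le_rfl⟩)
  -- The slope of `z` is at most `A * B` on `[t - 2q, t]`, which contains both delayed arguments
  -- because `h ≤ q`.
  have hLip : ∀ u v, u ∈ Icc (t - 2 * q) t → v ∈ Icc (t - 2 * q) t → u ≤ v →
      |z v - z u| ≤ A * B * |v - u| := by
    intro u v hu hv huv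
    have h1 := norm_image_sub_le_of_norm_deriv_right_le_segment (f := z)
      (f' := fun t => -a t * z (gridArg r h t)) (a := u) (b := v) (C := A * B)
      (hz.continuousOn.mono fun w hw => mem_Ici.2 (by linarith [hw.1, hu.1]))
      (fun w hw => hz.hasDerivWithinAt hh (by linarith [hw.1, hu.1]))
      (fun w hw => by
        refine (abs_neg_mul_le haA (by linarith [hw.1, hu.1]) _).trans ?_
        exact mul_le_mul_of_nonneg_left
          (hB w ⟨by linarith [hw.1, hu.1], by linarith [hw.2, hv.2]⟩) hA)
      v ⟨huv, le_rfl⟩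
    rwa [abs_of_nonneg (sub_nonneg.2 huv)]
  have hg : gridArg r h t ∈ Icc (t - 2 * q) t :=
    ⟨by linarith [sub_le_gridArg hrq hh ht0], gridArg_le hr0 hh ht0⟩
  have hd : t - r t ∈ Icc (t - 2 * q) t :=
    ⟨by linarith [hrq t ht0], by linarith [hr0 t ht0]⟩
  have h2 : |z (gridArg r h t) - z (t - r t)| ≤ A * B * |gridArg r h t - (t - r t)| := by
    rcases le_total (gridArg r h t) (t - r t) with h3 | h3
    · rw [abs_sub_comm, abs_sub_comm (gridArg r h t)]
      exact hLip _ _ hg hd h3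
    · exact hLip _ _ hd hg h3
  exact h2.trans (mul_le_mul_of_nonneg_left (abs_sub_gridArg_le hr0 hrq hh ht0) (by positivity))

/-- For small step sizes, solutions of the equation with piecewise constant argument decay
exponentially, uniformly in the step size. -/
theorem IsPiecewiseSolution.abs_le_exp (hz : IsPiecewiseSolution a r q h φ z)
    {K σ T : ℝ} (ha : ContinuousOn a (Ici 0)) (hr : ContinuousOn r (Ici 0)) (hq : 0 < q)
    (haA : ∀ t, 0 ≤ t → |a t| ≤ A) (hr0 : ∀ t, 0 ≤ t → 0 ≤ r t) (hrq : ∀ t, 0 ≤ t → r t ≤ q)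
    (hh : 0 < h) (hhq : h ≤ q) (hK : 0 ≤ K) (hσ : 0 ≤ σ) (hE : ExponentialEstimate a r q K σ)
    (hqT : 4 * q ≤ T) (hKT : K * Real.exp (-σ * (T - 4 * q)) ≤ 1 / 4)
    (hsmall : 2 * T * Real.exp ((2 * A + 1) * T) *
      (A ^ 2 * (2 * h + modulus r h) * (2 * Real.exp ((2 * A + 1) * T))) ≤ 1 / 4) :
    (∀ t, 0 ≤ t → |z t| ≤ 2 * (2 * Real.exp ((2 * A + 1) * T)) ^ 2 * ‖φ‖ *
      Real.exp (-(Real.log 2 / T) * (t - 4 * q))) ∧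
    ∀ t, 0 ≤ t → |z (gridArg r h t)| ≤ 2 * (2 * Real.exp ((2 * A + 1) * T)) ^ 2 * ‖φ‖ *
      Real.exp (-(Real.log 2 / T) * (t - 6 * q)) := by
  have hA : 0 ≤ A := (abs_nonneg _).trans (haA 0 le_rfl)
  have hT : 0 < T := by linarith
  set G : ℝ := 2 * Real.exp ((2 * A + 1) * T) with hG
  set κ : ℝ := A ^ 2 * (2 * h + modulus r h) with hκ
  set η : ℝ := Real.log 2 / T with hη
  have hη0 : 0 ≤ η := div_nonneg (Real.log_nonneg (by norm_num)) hT.le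
  have hκ0 : 0 ≤ κ := by
    have := modulus_nonneg (r := r) h
    positivity
  have hG1 : 1 ≤ G := by
    have : 1 ≤ Real.exp ((2 * A + 1) * T) := Real.one_le_exp (by positivity)
    linarith
  have hexp : ∀ u, u ≤ 4 * q → 1 ≤ Real.exp (-η * (u - 4 * q)) := fun u hu =>
    Real.one_le_exp (by nlinarith)
  have hinit : ∀ n : ℤ, (n : ℝ) * h ∈ Icc (-q) 0 → |z (n * h)| ≤ ‖φ‖ := fun n hn => by
    rw [hz.initial n hn]
    exact φ.norm_coe_le_norm _
  have hgrow0 : ∀ t ∈ Icc 0 T, |z t| ≤ G * ‖φ‖ := by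
    have := hz.abs_le_of_history haA hr0 hh le_rfl hT.le
      (by simpa using hinit 0 (by simp [hq.le]))
      (fun t ht hg => hz.abs_gridArg_le_norm hrq hh ht hg)
    simpa using this
  have hgrow : ∀ s, 4 * q ≤ s → ∀ B, (∀ u ∈ Icc (s - 4 * q) s, |z u| ≤ B) →
      ∀ t ∈ Icc s (s + T), |z t| ≤ G * B := fun s hs B hB =>
    hz.abs_le_of_history haA hr0 hh (by linarith) hT.le (hB s ⟨by linarith, le_rfl⟩)
      fun t ht hg => hB _ ⟨by linarith [sub_le_gridArg hrq hh (show 0 ≤ t by linarith)], hg⟩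
  -- Segments have length `4q`: the forcing at `u` is controlled by `gridArg r h ξ` with `ξ ≥ u -
  -- 2q`, and this lags `ξ` by at most `q + h ≤ 2q`. One quarter of `B` comes from the exponential
  -- estimate, the other from `hsmall`.
  have hhalf : ∀ s, 4 * q ≤ s → ∀ B, (∀ u ∈ Icc (s - 4 * q) s, |z u| ≤ B) →
      ∀ t ∈ Icc (s + T - 4 * q) (s + T), |z t| ≤ B * (1 / 2) := by
    intro s hs B hB t ht
    have hB0 : 0 ≤ B := (abs_nonneg _).trans (hB s ⟨by linarith, le_rfl⟩)
    have hall : ∀ u ∈ Icc (s - 4 * q) (s + T), |z u| ≤ G * B := by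
      intro u hu
      rcases le_total u s with h1 | h1
      · exact (hB u ⟨hu.1, h1⟩).trans (le_mul_of_one_le_left hB0 hG1)
      · exact hgrow s hs B hB u ⟨h1, hu.2⟩
    have h1 := abs_le_of_forced (f := fun t => -a t * (z (gridArg r h t) - z (t - r t)))
      (y := z) (s := s) (T := T) (N := B) (F := κ * (G * B)) ha hr hq.le haA hr0 hrq hK hE
      (by linarith) hT.le (by positivity)
      (hz.continuousOn.mono (Ici_subset_Ici.2 (by linarith)))
      (fun t ht => (hz.hasDerivWithinAt hh (by linarith)).congr_deriv (by ring))
      (fun u hu => hB u ⟨by linarith [hu.1], hu.2⟩)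
      (fun u hu => by
        refine (abs_neg_mul_le haA (by linarith [hu.1]) _).trans ?_
        have := hz.abs_sub_le haA hr0 hrq hh hhq (t := u) (B := G * B) (by linarith [hu.1])
          (fun ξ hξ => hall _ ⟨?_, ?_⟩)
        · calc _ ≤ A * (A * (G * B) * (2 * h + modulus r h)) := by gcongr
            _ = _ := by rw [hκ]; ring
        · linarith [sub_le_gridArg hrq hh (show 0 ≤ ξ by linarith [hξ.1, hu.1]), hξ.1, hu.1]
        · linarith [gridArg_le hr0 hh (show 0 ≤ ξ by linarith [hξ.1, hu.1]), hξ.2, hu.2])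
      t ⟨by linarith [ht.1], ht.2⟩
    refine h1.trans ?_
    have h2 : K * Real.exp (-σ * (t - s)) ≤ 1 / 4 := by
      refine le_trans (mul_le_mul_of_nonneg_left (Real.exp_le_exp.2 ?_) hK) hKT
      have : σ * (T - 4 * q) ≤ σ * (t - s) :=
        mul_le_mul_of_nonneg_left (by linarith [ht.1]) hσ
      linarith
    have h3 := mul_le_mul_of_nonneg_right h2 hB0
    have h4 := mul_le_mul_of_nonneg_right hsmall hB0
    linarith
  have hle : ∀ n : ℕ, 4 * q ≤ 4 * q + n * T := fun n => by
    have : 0 ≤ n * T := by positivity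
    linarith
  have hseg : ∀ n : ℕ, ∀ u ∈ Icc (4 * q + n * T - 4 * q) (4 * q + n * T),
      |z u| ≤ G * ‖φ‖ * (1 / 2) ^ n := by
    intro n
    induction n with
    | zero =>
      intro u hu
      simp only [Nat.cast_zero, zero_mul, add_zero, sub_self] at hu
      simpa using hgrow0 u ⟨hu.1, hu.2.trans hqT⟩
    | succ n ih =>
      intro u hu
      push_cast at hu
      rw [pow_succ, ← mul_assoc]
      exact hhalf _ (hle n) _ ih u ⟨by linarith [hu.1], by linarith [hu.2]⟩
  have hP : ‖φ‖ ≤ 2 * G ^ 2 * ‖φ‖ ∧ G * ‖φ‖ ≤ 2 * G ^ 2 * ‖φ‖ := by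
    constructor
    · exact le_mul_of_one_le_left (norm_nonneg _) (by nlinarith)
    · exact mul_le_mul_of_nonneg_right (by nlinarith) (norm_nonneg _)
  have hP0 : 0 ≤ 2 * G ^ 2 * ‖φ‖ := by positivity
  have hmain : ∀ t, 0 ≤ t → |z t| ≤ 2 * G ^ 2 * ‖φ‖ * Real.exp (-η * (t - 4 * q)) := by
    intro t ht
    rcases le_total t (4 * q) with h1 | h1
    · exact ((hgrow0 t ⟨ht, h1.trans hqT⟩).trans hP.2).trans
        (le_mul_of_one_le_right hP0 (hexp t h1))
    · have := le_exp_of_le_half_pow (v := fun t => |z t|) (s := 4 * q) (B := G * (G * ‖φ‖)) hT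
        (by positivity) (fun n u hu => by
          have := hgrow _ (hle n) _ (hseg n) u ⟨hu.1, by linarith [hu.2]⟩
          rwa [← mul_assoc G (G * ‖φ‖)] at this) t h1
      calc |z t| ≤ _ := this
        _ = _ := by ring
  refine ⟨hmain, fun t ht => ?_⟩
  have h1 : Real.exp (-η * (gridArg r h t - 4 * q)) ≤ Real.exp (-η * (t - 6 * q)) := by
    rw [Real.exp_le_exp]
    have := mul_le_mul_of_nonneg_left
      (show t - 6 * q ≤ gridArg r h t - 4 * q by linarith [sub_le_gridArg hrq hh ht]) hη0
    linarith
  refine le_trans ?_ (mul_le_mul_of_nonneg_left h1 hP0)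
  rcases le_total (gridArg r h t) 0 with h2 | h2
  · exact ((hz.abs_gridArg_le_norm hrq hh ht h2).trans hP.1).trans
      (le_mul_of_one_le_right hP0 (hexp _ (by linarith)))
  · exact hmain _ h2

end Piecewise

end DelayEq

/-! ### The error estimate. -/

theorem theorem4p1 (a r : ℝ → ℝ) (q : ℝ)
    (ha_nonneg : ∀ t, 0 ≤ t → 0 ≤ a t) (ha_cont : ContinuousOn a (Set.Ici 0))
    (hr_nonneg : ∀ t, 0 ≤ t → 0 ≤ r t) (hq : IsLUB (r '' Set.Ici 0) q) (hq_pos : 0 < q)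
    (A1 : DelayEq.UniformlyAsymptoticallyStable a r q)
    (A2 : BddAbove ((fun t => |a t|) '' Set.Ici 0))
    (A3 : UniformContinuousOn r (Set.Ici 0)) :
    ∃ K σ M₁ η h₀ : ℝ, 0 < K ∧ 0 < σ ∧ 0 < M₁ ∧ 0 < η ∧ 0 < h₀ ∧ h₀ ≤ q ∧
      DelayEq.ExponentialEstimate a r q K σ ∧
      (∀ h, 0 < h → h ≤ h₀ → ∀ (φ : C(Set.Icc (-q) 0, ℝ)) (x z : ℝ → ℝ),
        DelayEq.IsSolution a r q 0 φ x → DelayEq.IsPiecewiseSolution a r q h φ z →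
        ∀ t, DelayEq.startTime r q ≤ t →
          |x t - z t| ≤
            (K * DelayEq.segmentNorm q (fun s => x s - z s) (DelayEq.startTime r q)
              + DelayEq.errorCoeff a r K h * M₁ * ‖φ‖ * t)
            * Real.exp (-η * (t - DelayEq.startTime r q))) ∧
      Filter.Tendsto (DelayEq.errorCoeff a r K) (nhdsWithin 0 (Set.Ioi 0)) (nhds 0) := by
  have hrq : ∀ t, 0 ≤ t → r t ≤ q := fun t ht => hq.1 ⟨t, ht, rfl⟩
  have haA : ∀ t, 0 ≤ t → |a t| ≤ DelayEq.supAbs a := fun t ht => le_csSup A2 ⟨t, ht, rfl⟩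
  have hr_cont := A3.continuousOn
  obtain ⟨K, σ, hK, hσ, hE⟩ := A1.exists_exponentialEstimate hq_pos
  set A := DelayEq.supAbs a with hA
  have hA0 : 0 ≤ A := (abs_nonneg _).trans (haA 0 le_rfl)
  -- This gives `exp(-σ (T - 4q)) = 1 / (4K + 1)`, hence the factor `K / (4K + 1) ≤ 1 / 4`.
  set T : ℝ := 4 * q + Real.log (4 * K + 1) / σ with hT
  have hlog : 0 < Real.log (4 * K + 1) := Real.log_pos (by linarith)
  have hqT : 4 * q < T := by
    have : 0 < Real.log (4 * K + 1) / σ := by positivity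
    linarith
  have hT0 : 0 < T := by linarith
  have hKT : K * Real.exp (-σ * (T - 4 * q)) ≤ 1 / 4 := by
    have h1 : -σ * (T - 4 * q) = -Real.log (4 * K + 1) := by
      rw [hT]; field_simp; ring
    rw [h1, Real.exp_neg, Real.exp_log (by linarith), ← div_eq_mul_inv,
      div_le_iff₀ (by linarith)]
    linarith
  have hKTq : K * Real.exp (-σ * (T - q)) ≤ 1 / 4 := by
    refine le_trans (mul_le_mul_of_nonneg_left (Real.exp_le_exp.2 ?_) hK.le) hKT
    nlinarith
  set G : ℝ := 2 * Real.exp ((2 * A + 1) * T) with hG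
  set c : ℝ := 2 * T * Real.exp ((2 * A + 1) * T) with hc
  have hG0 : 0 < G := by positivity
  have hc0 : 0 < c := by positivity
  set η : ℝ := Real.log 2 / T with hη
  have hη0 : 0 < η := div_pos (Real.log_pos (by norm_num)) hT0
  obtain ⟨h₁, hh₁, hsmall⟩ : ∃ h₁ > 0, ∀ h, 0 < h → h ≤ h₁ →
      c * (A ^ 2 * (2 * h + DelayEq.modulus r h) * G) ≤ 1 / 4 := by
    have h1 : Filter.Tendsto (fun h => c * DelayEq.errorCoeff a r G h)
        (nhdsWithin 0 (Set.Ioi 0)) (nhds (c * 0)) :=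
      (DelayEq.tendsto_errorCoeff a A3 G).const_mul c
    rw [mul_zero] at h1
    have h2 := h1.eventually (eventually_le_nhds (show (0 : ℝ) < 1 / 4 by norm_num))
    obtain ⟨u, hu, h3⟩ := mem_nhdsGT_iff_exists_Ioc_subset.1 h2
    exact ⟨u, hu, fun h h0 hhu => h3 ⟨h0, hhu⟩⟩
  -- The shift `8q` is the `6q` in the decay of the delayed values plus the `2q` by which `ξ`
  -- precedes `u`.
  set P : ℝ := 2 * G ^ 2 * Real.exp (8 * q * η) with hP
  have hP0 : 0 < P := by positivity
  -- The factor 2 in `abs_le_exp_of_forced` forces `2 * K`. The `3 * q` in `M₁` pays for the factor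
  -- `t`: the argument gives a bound without it, and `t / (3q) ≥ 1` since `t ≥ t₀ ≥ 3q`.
  refine ⟨2 * K, σ, (4 * K + 1) * c * P / (K * (3 * q)), η, min h₁ q, by positivity, hσ,
    by positivity, hη0, lt_min hh₁ hq_pos, min_le_right _ _, ?_, ?_,
    DelayEq.tendsto_errorCoeff a A3 _⟩
  · intro s hs φ x hx t ht
    refine (hE s hs φ x hx t ht).trans ?_
    gcongr
    linarith
  intro h hh hhle φ x z hx hz t ht
  have hhq : h ≤ q := hhle.trans (min_le_right _ _)
  have hw : 0 ≤ DelayEq.modulus r h := DelayEq.modulus_nonneg h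
  set t₀ := DelayEq.startTime r q with ht₀
  have ht₀q : 3 * q ≤ t₀ := by
    have : 0 ≤ DelayEq.modulus r q := DelayEq.modulus_nonneg q
    rw [ht₀, DelayEq.startTime]
    linarith
  set κ : ℝ := A ^ 2 * (2 * h + DelayEq.modulus r h) with hκ
  have hκ0 : 0 ≤ κ := by positivity
  have hzexp := (hz.abs_le_exp ha_cont hr_cont hq_pos haA hr_nonneg hrq hh hhq hK.le hσ.le hE
    hqT.le hKT (hsmall h hh (hhle.trans (min_le_left _ _)))).2
  have hcont : ContinuousOn (fun s => x s - z s) (Set.Ici (t₀ - q)) :=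
    (hx.continuousOn.mono (Set.Ici_subset_Ici.2 (by linarith))).sub
      (hz.continuousOn.mono (Set.Ici_subset_Ici.2 (by linarith)))
  have hseg : ∀ u ∈ Set.Icc (t₀ - q) t₀,
      |x u - z u| ≤ DelayEq.segmentNorm q (fun s => x s - z s) t₀ := by
    intro u hu
    refine le_csSup ?_ ⟨u - t₀, ⟨by linarith [hu.1], by linarith [hu.2]⟩, by simp⟩
    refine (isCompact_Icc.image_of_continuousOn ?_).bddAbove
    refine (hcont.comp (by fun_prop) fun θ hθ => ?_).abs
    simp only [Set.mem_Ici]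
    linarith [hθ.1]
  have hmain := DelayEq.abs_le_exp_of_forced
    (f := fun t => -a t * -(z (DelayEq.gridArg r h t) - z (t - r t)))
    (y := fun s => x s - z s) (s := t₀) (T := T) (F := κ * P * ‖φ‖)
    ha_cont hr_cont hq_pos.le haA hr_nonneg hrq hK.le hσ.le hE (by linarith) hT0 (by linarith)
    hKTq (by positivity) hcont
    (fun u hu => ((hx.equation u (by linarith)).sub
      (hz.hasDerivWithinAt hh (by linarith))).congr_deriv (by ring))
    hseg
    (fun n u hu => by
      have hn : 0 ≤ n * T := by positivity
      have hu1 := hu.1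
      refine (DelayEq.abs_neg_mul_le haA (by linarith) _).trans ?_
      rw [abs_neg]
      have h1 := hz.abs_sub_le haA hr_nonneg hrq hh hhq (t := u)
        (B := 2 * G ^ 2 * ‖φ‖ * (Real.exp (8 * q * η) * (1 / 2) ^ n)) (by linarith)
        (fun ξ hξ => by
          refine (hzexp ξ (by linarith [hξ.1])).trans ?_
          -- Since `η T = log 2`, halving per window is exactly decay at rate `η`.
          have h2 : Real.exp (8 * q * η) * (1 / 2) ^ n
              = Real.exp (8 * q * η + n * -(η * T)) := by
            rw [Real.exp_add, Real.exp_nat_mul, hη, div_mul_cancel₀ _ hT0.ne', Real.exp_neg,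
              Real.exp_log (by norm_num)]
            norm_num
          rw [h2]
          have h3 : η * (n * T - 8 * q) ≤ η * (ξ - 6 * q) :=
            mul_le_mul_of_nonneg_left (by linarith [hξ.1]) hη0.le
          refine mul_le_mul_of_nonneg_left (Real.exp_le_exp.2 (by linarith)) (by positivity))
      refine (mul_le_mul_of_nonneg_left h1 hA0).trans (le_of_eq ?_)
      rw [hκ, hP]
      ring)
    t ht
  refine hmain.trans ?_
  refine mul_le_mul_of_nonneg_right ?_ (Real.exp_pos _).le
  have h1 : DelayEq.errorCoeff a r (2 * K) h * ((4 * K + 1) * c * P / (K * (3 * q))) * ‖φ‖ * t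
      = 2 * (4 * K + 1) * c * κ * P * ‖φ‖ * (t / (3 * q)) := by
    rw [DelayEq.errorCoeff, ← hA, hκ]
    field_simp
  have h2 : 1 ≤ t / (3 * q) := by
    rw [one_le_div (by positivity)]
    linarith
  have h3 : 2 * (4 * K + 1) * c * κ * P * ‖φ‖
      ≤ 2 * (4 * K + 1) * c * κ * P * ‖φ‖ * (t / (3 * q)) :=
    le_mul_of_one_le_right (by positivity) h2
  rw [h1]
  linarith
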